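/- Let $\Omega\subset\mathbb R^n$ be a bounded open set, let $0<m\le M$, and let $a\in L^\infty(\Omega)$ satisfy $m\le a\le M$ a.e. in $\Omega$. Let $H\in L^2(\Omega)$ and $F,\tilde F\in L^2(\Omega)^n$. Here $H^1_0(\Omega)$ is the closure of $C_c^\infty(\Omega)$ in $H^1(\Omega)$. Assume that $u$ minimizes $$w\mapsto\int_\Omega \big(a|Dw+F|+Hw\big)\,dx$$ over $H_0^1(\Omega)$ and that $\tilde u$ minimizes $$w\mapsto\int_\Omega \big(a|Dw+\tilde F|+Hw\big)\,dx$$ over $H_0^1(\Omega)$. Let $J$ and $\tilde J$ be associated fluxes, that is, solutions of the dual problems of maximizing $\int_\Omega F\cdot b\,dx$ and $\int_\Omega\tilde F\cdot b\,dx$, respectively, over all $b\in L^2(\Omega)^n$ with $|b|\le a$ a.e. in $\Omega$ and $$\int_\Omega(\nabla w\cdot b+Hw)\,dx=0\quad\text{for all }w\in H_0^1(\Omega).$$ Let $\sigma=a/|Du+F|$ (equal to $+\infty$ where $Du+F=0$), and suppose that $0\le\sigma\le\sigma_1$ a.e. in $\Omega$ for some constant $\sigma_1>0$. Then $$\|J-\tilde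 J\|_{L^1(\Omega)}\le(4M\sigma_1|\Omega|)^{1/2}\,\|F-\tilde F\|_{L^1(\Omega)}^{1/2}.$$ -/

import Mathlib

open MeasureTheory Filter Topology
open scoped ENNReal ContDiff

noncomputable section

namespace LeastGradient

/-- The Euclidean space `ℝⁿ`. -/
abbrev Space (n : ℕ) : Type := EuclideanSpace ℝ (Fin n)

/-- Lebesgue measure on `Ω`. -/
abbrev leb {n : ℕ} (Ω : Set (Space n)) : Measure (Space n) := volume.restrict Ω

/-- `φ ∈ C_c^∞(Ω)`. -/
def IsTestFunction {n : ℕ} (Ω : Set (Space n)) (φ : Space n → ℝ) : Prop :=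
  ContDiff ℝ ∞ φ ∧ HasCompactSupport φ ∧ tsupport φ ⊆ Ω

/-- `Du` is the weak (distributional) gradient of `u` in `Ω`. -/
def HasWeakGradient {n : ℕ} (Ω : Set (Space n)) (u : Space n → ℝ) (Du : Space n → Space n) :
    Prop :=
  ∀ φ : Space n → ℝ, IsTestFunction Ω φ →
    ∫ x in Ω, u x • gradient φ x = - ∫ x in Ω, φ x • Du x

/-- `u ∈ H¹(Ω)`, with weak gradient `Du`. -/
structure MemH1 {n : ℕ} (Ω : Set (Space n)) (u : Space n → ℝ) (Du : Space n → Space n) :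
    Prop where
  memLp : MemLp u 2 (leb Ω)
  memLp_grad : MemLp Du 2 (leb Ω)
  hasWeakGradient : HasWeakGradient Ω u Du

/-- `u ∈ H¹₀(Ω)`, the closure of `C_c^∞(Ω)` in `H¹(Ω)`, with weak gradient `Du`. -/
structure MemH10 {n : ℕ} (Ω : Set (Space n)) (u : Space n → ℝ) (Du : Space n → Space n) :
    Prop extends MemH1 Ω u Du where
  approx : ∃ φ : ℕ → Space n → ℝ, (∀ k, IsTestFunction Ω (φ k)) ∧
    Tendsto (fun k => eLpNorm (fun x => φ k x - u x) 2 (leb Ω)) atTop (𝓝 0) ∧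
    Tendsto (fun k => eLpNorm (fun x => gradient (φ k) x - Du x) 2 (leb Ω)) atTop (𝓝 0)

/-- The functional `w ↦ ∫_Ω (a |Dw + F| + H w) dx`. -/
def energy {n : ℕ} (Ω : Set (Space n)) (a : Space n → ℝ) (F : Space n → Space n)
    (H : Space n → ℝ) (w : Space n → ℝ) (Dw : Space n → Space n) : ℝ :=
  ∫ x in Ω, (a x * ‖Dw x + F x‖ + H x * w x)

/-- `u`, with weak gradient `Du`, minimizes `∫_Ω (a |Dw + F| + H w) dx` over `w ∈ H¹₀(Ω)`. -/
def IsMinimizer {n : ℕ} (Ω : Set (Space n)) (a : Space n → ℝ) (F : Space n → Space n)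
    (H : Space n → ℝ) (u : Space n → ℝ) (Du : Space n → Space n) : Prop :=
  MemH10 Ω u Du ∧
    ∀ (w : Space n → ℝ) (Dw : Space n → Space n), MemH10 Ω w Dw →
      energy Ω a F H u Du ≤ energy Ω a F H w Dw

/-- `b ∈ 𝒟₀`: `b ∈ L²(Ω)ⁿ` and `∫_Ω (∇w · b + H w) dx = 0` for all `w ∈ H¹₀(Ω)`. -/
def MemD0 {n : ℕ} (Ω : Set (Space n)) (H : Space n → ℝ) (b : Space n → Space n) : Prop :=
  MemLp b 2 (leb Ω) ∧
    ∀ (w : Space n → ℝ) (Dw : Space n → Space n), MemH10 Ω w Dw →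
      ∫ x in Ω, (inner ℝ (Dw x) (b x) + H x * w x) = 0

/-- `b` is admissible in the dual problem: `b ∈ 𝒟₀` and `|b| ≤ a` a.e. in `Ω`. -/
def DualFeasible {n : ℕ} (Ω : Set (Space n)) (a : Space n → ℝ) (H : Space n → ℝ)
    (b : Space n → Space n) : Prop :=
  MemD0 Ω H b ∧ ∀ᵐ x ∂leb Ω, ‖b x‖ ≤ a x

/-- `J` is a flux, i.e. a solution of the dual problem
`sup {⟨F, b⟩ : b ∈ 𝒟₀, |b| ≤ a a.e. in Ω}`. -/
def IsFlux {n : ℕ} (Ω : Set (Space n)) (a : Space n → ℝ) (F : Space n → Space n)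
    (H : Space n → ℝ) (J : Space n → Space n) : Prop :=
  DualFeasible Ω a H J ∧
    ∀ b : Space n → Space n, DualFeasible Ω a H b →
      ∫ x in Ω, inner ℝ (F x) (b x) ≤ ∫ x in Ω, inner ℝ (F x) (J x)

/-- The coefficient `σ = a / |Du + F|`, with values in `[0, ∞]`; it is `∞` where
`Du + F = 0 < a`. -/
def sigma {n : ℕ} (a : Space n → ℝ) (F : Space n → Space n) (Du : Space n → Space n)
    (x : Space n) : ℝ≥0∞ :=
  ENNReal.ofReal (a x) / ENNReal.ofReal ‖Du x + F x‖

end LeastGradient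

end

/-!
The fluxes are compared through the vector field `J₀ = (a / |V|) V`, where `V = Du + F`. The bound
`σ = a / |V| ≤ σ₁` forces `V ≠ 0` a.e., so no subdifferential is involved, and it gives a quadratic
upper bound for the energy around `u` with linear part `∫ (⟪Dw, J₀⟫ + H w)`. Since `u` is a
minimizer, this linear part vanishes for every `w ∈ H¹₀(Ω)`, i.e. `J₀` is admissible in the dual
problem (`dualFeasible_smul_of_isMinimizer`).

If `|b| ≤ a`, then expanding the square gives the pointwise coercivity estimate
`|J₀ - b|² ≤ 2 σ ⟪V, J₀ - b⟫`. For admissible `b` the term `∫ ⟪Du, J₀ - b⟫` vanishes, whence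
`∫ |J₀ - b|² ≤ 2 σ₁ ∫ ⟪F, J₀ - b⟫` (`integral_norm_sub_sq_le`). With `b = J` the right-hand side is
nonpositive by maximality of `J`, so `J = J₀` a.e. With `b = J'`, write
`⟪F, J - J'⟫ = ⟪F - F', J - J'⟫ + ⟪F', J - J'⟫`; the last term has nonpositive integral by maximality
of `J'`, and `|J - J'| ≤ 2 M`. Hence `∫ |J - J'|² ≤ 4 M σ₁ ∫ |F - F'|`, and the Cauchy–Schwarz
inequality on `Ω` finishes the proof.
-/

namespace LeastGradient

/-! ### Integrals of square-integrable functions -/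

section L2

variable {α E : Type*} [MeasurableSpace α] {μ : Measure α} [NormedAddCommGroup E]

theorem integral_norm_le_sqrt_mul_sqrt [IsFiniteMeasure μ] {f : α → E} (hf : MemLp f 2 μ) :
    ∫ x, ‖f x‖ ∂μ ≤ (∫ x, ‖f x‖ ^ 2 ∂μ) ^ (1 / 2 : ℝ) * μ.real Set.univ ^ (1 / 2 : ℝ) := by
  have h := integral_mul_le_Lp_mul_Lq_of_nonneg (μ := μ) Real.HolderConjugate.two_two
    (f := fun x => ‖f x‖) (g := fun _ => (1 : ℝ)) (ae_of_all _ fun _ => norm_nonneg _)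
    (ae_of_all _ fun _ => zero_le_one) (by simpa using hf.norm) (memLp_const 1)
  simpa using h

variable [InnerProductSpace ℝ E]

theorem integrable_inner_of_memLp_two {f g : α → E} (hf : MemLp f 2 μ) (hg : MemLp g 2 μ) :
    Integrable (fun x => inner ℝ (f x) (g x)) μ :=
  (hf.norm.integrable_mul hg.norm).mono (hf.1.inner hg.1)
    (ae_of_all _ fun x => by
      simpa using abs_real_inner_le_norm (f x) (g x))

theorem integrable_smul_of_memLp_two {f : α → ℝ} {g : α → E} (hf : MemLp f 2 μ)
    (hg : MemLp g 2 μ) : Integrable (fun x => f x • g x) μ :=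
  (hf.norm.integrable_mul hg.norm).mono (hf.1.smul hg.1)
    (ae_of_all _ fun x => by simp [norm_smul])

end L2

/-! ### Linear structure of `H¹₀(Ω)` -/

section Sobolev

variable {n : ℕ} {Ω : Set (Space n)}

theorem gradient_add_const_mul {φ ψ : Space n → ℝ} (hφ : Differentiable ℝ φ)
    (hψ : Differentiable ℝ ψ) (t : ℝ) (x : Space n) :
    gradient (fun y => φ y + t * ψ y) x = gradient φ x + t • gradient ψ x := by
  simp only [gradient]
  rw [fderiv_fun_add (hφ x) ((hψ x).const_mul t), fderiv_const_mul (hψ x)]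
  simp

theorem IsTestFunction.differentiable {φ : Space n → ℝ} (hφ : IsTestFunction Ω φ) :
    Differentiable ℝ φ :=
  hφ.1.differentiable (by simp)

theorem IsTestFunction.memLp {φ : Space n → ℝ} (hφ : IsTestFunction Ω φ) :
    MemLp φ 2 (leb Ω) :=
  hφ.1.continuous.memLp_of_hasCompactSupport hφ.2.1

theorem IsTestFunction.memLp_gradient {φ : Space n → ℝ} (hφ : IsTestFunction Ω φ) :
    MemLp (gradient φ) 2 (leb Ω) := by
  have hc : Continuous (gradient φ) :=
    (LinearIsometryEquiv.continuous _).comp (hφ.1.continuous_fderiv (by simp))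
  refine hc.memLp_of_hasCompactSupport ?_
  exact (hφ.2.1.fderiv (𝕜 := ℝ)).comp_left (map_zero _)

theorem IsTestFunction.add_const_mul {φ ψ : Space n → ℝ} (hφ : IsTestFunction Ω φ)
    (hψ : IsTestFunction Ω ψ) (t : ℝ) : IsTestFunction Ω (fun x => φ x + t * ψ x) := by
  refine ⟨hφ.1.add (contDiff_const.mul hψ.1), hφ.2.1.add (hψ.2.1.mul_left (f := fun _ => t)), ?_⟩
  refine (tsupport_add φ (fun x => t * ψ x)).trans (Set.union_subset hφ.2.2 ?_)
  exact (tsupport_mul_subset_right (f := fun _ => t) (g := ψ)).trans hψ.2.2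

theorem HasWeakGradient.add_const_mul {u w : Space n → ℝ} {Du Dw : Space n → Space n}
    (hu : MemH1 Ω u Du) (hw : MemH1 Ω w Dw) (t : ℝ) :
    HasWeakGradient Ω (fun x => u x + t * w x) (fun x => Du x + t • Dw x) := by
  intro φ hφ
  have hu' := hu.hasWeakGradient φ hφ
  have hw' := hw.hasWeakGradient φ hφ
  have h₁ : ∫ x in Ω, (u x + t * w x) • gradient φ x
      = ∫ x in Ω, u x • gradient φ x + t • (w x • gradient φ x) := by
    simp only [add_smul, mul_smul]
  have h₂ : ∫ x in Ω, φ x • (Du x + t • Dw x)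
      = ∫ x in Ω, φ x • Du x + t • (φ x • Dw x) := by
    simp only [smul_add, smul_comm t]
  have hi₁ : Integrable (fun x => t • (w x • gradient φ x)) (leb Ω) :=
    (integrable_smul_of_memLp_two hw.memLp hφ.memLp_gradient).smul t
  have hi₂ : Integrable (fun x => t • (φ x • Dw x)) (leb Ω) :=
    (integrable_smul_of_memLp_two hφ.memLp hw.memLp_grad).smul t
  rw [h₁, h₂, integral_add (integrable_smul_of_memLp_two hu.memLp hφ.memLp_gradient) hi₁,
    integral_add (integrable_smul_of_memLp_two hφ.memLp hu.memLp_grad) hi₂,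
    integral_smul, integral_smul, hu', hw']
  module

theorem tendsto_eLpNorm_add_const_smul {α E : Type*} [MeasurableSpace α] {μ : Measure α}
    [NormedAddCommGroup E] [NormedSpace ℝ E] {f g : ℕ → α → E}
    (hfm : ∀ k, AEStronglyMeasurable (f k) μ) (hgm : ∀ k, AEStronglyMeasurable (g k) μ)
    (hf : Tendsto (fun k => eLpNorm (f k) 2 μ) atTop (𝓝 0))
    (hg : Tendsto (fun k => eLpNorm (g k) 2 μ) atTop (𝓝 0)) (t : ℝ) :
    Tendsto (fun k => eLpNorm (f k + t • g k) 2 μ) atTop (𝓝 0) := by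
  have hlim : Tendsto (fun k => eLpNorm (f k) 2 μ + ‖t‖ₑ * eLpNorm (g k) 2 μ) atTop (𝓝 0) := by
    simpa using hf.add (ENNReal.Tendsto.const_mul hg (Or.inr enorm_ne_top))
  refine tendsto_of_tendsto_of_tendsto_of_le_of_le tendsto_const_nhds hlim
    (fun _ => zero_le) fun k => ?_
  refine (eLpNorm_add_le (hfm k) ((hgm k).const_smul t) (by norm_num)).trans ?_
  rw [eLpNorm_const_smul]

theorem MemH10.add_const_mul {u w : Space n → ℝ} {Du Dw : Space n → Space n}
    (hu : MemH10 Ω u Du) (hw : MemH10 Ω w Dw) (t : ℝ) :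
    MemH10 Ω (fun x => u x + t * w x) (fun x => Du x + t • Dw x) := by
  obtain ⟨φ, hφ, hφu, hφDu⟩ := hu.approx
  obtain ⟨ψ, hψ, hψw, hψDw⟩ := hw.approx
  refine ⟨⟨hu.memLp.add (hw.memLp.const_mul t), hu.memLp_grad.add (hw.memLp_grad.const_smul t),
    HasWeakGradient.add_const_mul hu.toMemH1 hw.toMemH1 t⟩,
    fun k x => φ k x + t * ψ k x, fun k => (hφ k).add_const_mul (hψ k) t, ?_, ?_⟩
  · convert! tendsto_eLpNorm_add_const_smul (fun k => ((hφ k).memLp.sub hu.memLp).1)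
      (fun k => ((hψ k).memLp.sub hw.memLp).1) hφu hψw t using 3 with k
    ext x
    simp only [Pi.add_apply, Pi.sub_apply, Pi.smul_apply, smul_eq_mul]
    ring
  · convert! tendsto_eLpNorm_add_const_smul
      (fun k => ((hφ k).memLp_gradient.sub hu.memLp_grad).1)
      (fun k => ((hψ k).memLp_gradient.sub hw.memLp_grad).1) hφDu hψDw t using 3 with k
    funext x
    rw [gradient_add_const_mul (hφ k).differentiable (hψ k).differentiable]
    simp only [Pi.add_apply, Pi.sub_apply, Pi.smul_apply]
    module

end Sobolev

/-! ### Pointwise estimates -/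

section Pointwise

variable {E : Type*} [NormedAddCommGroup E] [InnerProductSpace ℝ E]

/-- Quadratic upper bound for `s ‖v‖ ‖·‖` around `v`. It follows from
`2 ‖v‖ ‖v + w‖ ≤ ‖v‖² + ‖v + w‖²`. -/
theorem mul_norm_mul_norm_add_le {s : ℝ} (hs : 0 ≤ s) (v w : E) :
    s * ‖v‖ * ‖v + w‖ ≤ s * ‖v‖ * ‖v‖ + inner ℝ w (s • v) + s / 2 * ‖w‖ ^ 2 := by
  have h₁ := norm_add_sq_real v w
  have h₂ := mul_nonneg hs (sq_nonneg (‖v‖ - ‖v + w‖))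
  rw [inner_smul_right, real_inner_comm]
  linear_combination h₂ / 2 + s / 2 * h₁

/-- Coercivity of `b ↦ -⟪v, b⟫` at its minimizer `s • v` on the ball of radius `s ‖v‖`. -/
theorem norm_smul_sub_sq_le {s : ℝ} (hs : 0 ≤ s) {v b : E} (hb : ‖b‖ ≤ s * ‖v‖) :
    ‖s • v - b‖ ^ 2 ≤ 2 * s * inner ℝ v (s • v - b) := by
  have h₁ := norm_sub_sq_real (s • v) b
  rw [norm_smul, Real.norm_of_nonneg hs, real_inner_smul_left] at h₁
  have h₂ : ‖b‖ ^ 2 ≤ (s * ‖v‖) ^ 2 := pow_le_pow_left₀ (norm_nonneg b) hb 2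
  rw [inner_sub_right, real_inner_smul_right, real_inner_self_eq_norm_sq]
  linear_combination h₂ + h₁

theorem inner_smul_sub_nonneg {s : ℝ} {v b : E} (hb : ‖b‖ ≤ s * ‖v‖) :
    0 ≤ inner ℝ v (s • v - b) := by
  have h := (real_inner_le_norm v b).trans (mul_le_mul_of_nonneg_left hb (norm_nonneg v))
  rw [inner_sub_right, real_inner_smul_right, real_inner_self_eq_norm_sq]
  linarith

end Pointwise

/-! ### The flux of a minimizer -/

section Flux

variable {n : ℕ} {Ω : Set (Space n)} {a H : Space n → ℝ} {F Du : Space n → Space n}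
  {u : Space n → ℝ}

/-- The bound on `sigma` excludes `Du + F = 0`, since `sigma` is infinite there. -/
theorem ae_eq_div_norm_mul_norm_of_sigma_le {m M σ₁ : ℝ} (hm : 0 < m) (hσ₁ : 0 < σ₁)
    (ha : ∀ᵐ x ∂leb Ω, m ≤ a x ∧ a x ≤ M)
    (hσ : ∀ᵐ x ∂leb Ω, sigma a F Du x ≤ ENNReal.ofReal σ₁) :
    ∀ᵐ x ∂leb Ω, 0 ≤ a x / ‖Du x + F x‖ ∧ a x / ‖Du x + F x‖ ≤ σ₁ ∧
      a x = a x / ‖Du x + F x‖ * ‖Du x + F x‖ := by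
  filter_upwards [ha, hσ] with x hax hσx
  have ha0 : 0 < a x := hm.trans_le hax.1
  have hV : 0 < ‖Du x + F x‖ := by
    refine (norm_nonneg _).lt_of_ne fun h => ?_
    rw [sigma, ← h, ENNReal.ofReal_zero,
      ENNReal.div_zero (ENNReal.ofReal_pos.2 ha0).ne'] at hσx
    exact ENNReal.ofReal_ne_top (top_le_iff.1 hσx)
  refine ⟨by positivity, ?_, (div_mul_cancel₀ _ hV.ne').symm⟩
  rwa [sigma, ← ENNReal.ofReal_div_of_pos hV, ENNReal.ofReal_le_ofReal_iff hσ₁.le] at hσx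

/-- First-order condition for a minimizer `u` whose coefficient `s = a / ‖Du + F‖` is bounded: the
field `s • (Du + F)` is admissible in the dual problem. Boundedness of `s` makes the energy at
`u + t w` at most the energy at `u` plus `t A + t² B`, with `A` the linear functional that has to
vanish. -/
theorem dualFeasible_smul_of_isMinimizer [IsFiniteMeasure (leb Ω)] {M σ₁ : ℝ} {s : Space n → ℝ}
    (ha_meas : AEStronglyMeasurable a (leb Ω)) (haM : ∀ᵐ x ∂leb Ω, a x ≤ M)
    (hH : MemLp H 2 (leb Ω)) (hF : MemLp F 2 (leb Ω)) (hu : IsMinimizer Ω a F H u Du)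
    (hs_meas : AEStronglyMeasurable s (leb Ω))
    (hs : ∀ᵐ x ∂leb Ω, 0 ≤ s x ∧ s x ≤ σ₁ ∧ a x = s x * ‖Du x + F x‖) :
    DualFeasible Ω a H (fun x => s x • (Du x + F x)) := by
  have hV : MemLp (fun x => Du x + F x) 2 (leb Ω) := hu.1.memLp_grad.add hF
  have hbound : ∀ᵐ x ∂leb Ω, ‖s x • (Du x + F x)‖ = a x := by
    filter_upwards [hs] with x hx
    rw [norm_smul, Real.norm_of_nonneg hx.1, ← hx.2.2]
  have hJ : MemLp (fun x => s x • (Du x + F x)) 2 (leb Ω) :=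
    MemLp.of_bound (hs_meas.smul hV.1) M (by
      filter_upwards [hbound, haM] with x h₁ h₂ using h₁.trans_le h₂)
  have ha2 : MemLp a 2 (leb Ω) :=
    MemLp.of_bound ha_meas M (by
      filter_upwards [haM, hbound] with x h₁ h₂
      rwa [Real.norm_of_nonneg (h₂ ▸ norm_nonneg _)])
  refine ⟨⟨hJ, fun w Dw hw => ?_⟩, hbound.mono fun x hx => hx.le⟩
  have hlin : Integrable (fun x => inner ℝ (Dw x) (s x • (Du x + F x)) + H x * w x) (leb Ω) :=
    (integrable_inner_of_memLp_two hw.memLp_grad hJ).add (hH.integrable_mul hw.memLp)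
  have hquad : Integrable (fun x => σ₁ / 2 * ‖Dw x‖ ^ 2) (leb Ω) :=
    (hw.memLp_grad.norm.integrable_sq).const_mul _
  have henergy : Integrable (fun x => a x * ‖Du x + F x‖ + H x * u x) (leb Ω) :=
    (ha2.integrable_mul hV.norm).add (hH.integrable_mul hu.1.memLp)
  have hpos : ∀ t : ℝ, 0 ≤ (∫ x in Ω, σ₁ / 2 * ‖Dw x‖ ^ 2) * (t * t)
      + (∫ x in Ω, inner ℝ (Dw x) (s x • (Du x + F x)) + H x * w x) * t + 0 := by
    intro t
    have hwt := hu.1.add_const_mul hw t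
    have hmin := hu.2 _ _ hwt
    have hpert : Integrable (fun x => t * (inner ℝ (Dw x) (s x • (Du x + F x)) + H x * w x)
        + t ^ 2 * (σ₁ / 2 * ‖Dw x‖ ^ 2)) (leb Ω) :=
      (hlin.const_mul t).add (hquad.const_mul (t ^ 2))
    have hle : energy Ω a F H (fun x => u x + t * w x) (fun x => Du x + t • Dw x) ≤
        ∫ x in Ω, (a x * ‖Du x + F x‖ + H x * u x)
          + (t * (inner ℝ (Dw x) (s x • (Du x + F x)) + H x * w x)
            + t ^ 2 * (σ₁ / 2 * ‖Dw x‖ ^ 2)) := by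
      refine integral_mono_ae
        ((ha2.integrable_mul (hwt.memLp_grad.add hF).norm).add (hH.integrable_mul hwt.memLp))
        (henergy.add hpert) ?_
      filter_upwards [hs] with x ⟨h0, h1, h2⟩
      have h := mul_norm_mul_norm_add_le h0 (Du x + F x) (t • Dw x)
      have hsq : s x / 2 * (t ^ 2 * ‖Dw x‖ ^ 2) ≤ σ₁ / 2 * (t ^ 2 * ‖Dw x‖ ^ 2) := by gcongr
      have hn : ‖t • Dw x‖ ^ 2 = t ^ 2 * ‖Dw x‖ ^ 2 := by
        rw [norm_smul, mul_pow, Real.norm_eq_abs, sq_abs]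
      rw [real_inner_smul_left, hn, ← h2, add_right_comm] at h
      linear_combination h + hsq
    rw [integral_add henergy hpert,
      integral_add (hlin.const_mul t) (hquad.const_mul (t ^ 2)), integral_const_mul,
      integral_const_mul (t ^ 2)] at hle
    have h := hmin.trans hle
    rw [energy] at h
    linear_combination h
  -- A quadratic polynomial that vanishes at zero and is nonnegative has no linear term.
  have hdisc := discrim_le_zero hpos
  rw [discrim, mul_zero, sub_zero] at hdisc
  exact pow_eq_zero_iff two_ne_zero |>.1 (le_antisymm hdisc (sq_nonneg _))

theorem MemD0.integral_inner_sub_eq_zero {b c : Space n → Space n} {w : Space n → ℝ}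
    {Dw : Space n → Space n} (hH : MemLp H 2 (leb Ω)) (hb : MemD0 Ω H b) (hc : MemD0 Ω H c)
    (hw : MemH10 Ω w Dw) : ∫ x in Ω, inner ℝ (Dw x) (b x - c x) = 0 := by
  have hHw : Integrable (fun x => H x * w x) (leb Ω) := hH.integrable_mul hw.memLp
  have h := integral_sub ((integrable_inner_of_memLp_two hw.memLp_grad hb.1).add hHw)
    ((integrable_inner_of_memLp_two hw.memLp_grad hc.1).add hHw)
  simp only [Pi.add_apply, add_sub_add_right_eq_sub, ← inner_sub_right] at h
  rw [h, hb.2 w Dw hw, hc.2 w Dw hw, sub_zero]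

/-- Coercivity of the dual problem at the flux `s • (Du + F)`. -/
theorem integral_norm_sub_sq_le {σ₁ : ℝ} {s : Space n → ℝ} {b : Space n → Space n}
    (hH : MemLp H 2 (leb Ω)) (hF : MemLp F 2 (leb Ω)) (hu : MemH10 Ω u Du)
    (hs : ∀ᵐ x ∂leb Ω, 0 ≤ s x ∧ s x ≤ σ₁ ∧ a x = s x * ‖Du x + F x‖)
    (hJ : DualFeasible Ω a H (fun x => s x • (Du x + F x))) (hb : DualFeasible Ω a H b) :
    ∫ x in Ω, ‖s x • (Du x + F x) - b x‖ ^ 2 ≤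
      2 * σ₁ * ∫ x in Ω, inner ℝ (F x) (s x • (Du x + F x) - b x) := by
  have hd : MemLp (fun x => s x • (Du x + F x) - b x) 2 (leb Ω) := hJ.1.1.sub hb.1.1
  have hiD := integrable_inner_of_memLp_two hu.memLp_grad hd
  have hiF := integrable_inner_of_memLp_two hF hd
  have hV : ∫ x in Ω, inner ℝ (F x) (s x • (Du x + F x) - b x) =
      ∫ x in Ω, inner ℝ (Du x + F x) (s x • (Du x + F x) - b x) := by
    simp only [inner_add_left]
    rw [integral_add hiD hiF, hJ.1.integral_inner_sub_eq_zero hH hb.1 hu, zero_add]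
  rw [hV, ← integral_const_mul]
  refine integral_mono_ae hd.norm.integrable_sq
    ((integrable_inner_of_memLp_two (hu.memLp_grad.add hF) hd).const_mul _) ?_
  filter_upwards [hs, hb.2] with x ⟨h0, h1, h2⟩ hbx
  rw [h2] at hbx
  refine (norm_smul_sub_sq_le h0 hbx).trans ?_
  exact mul_le_mul_of_nonneg_right (by linarith) (inner_smul_sub_nonneg hbx)

theorem IsFlux.integral_inner_sub_nonpos {J b : Space n → Space n} (hF : MemLp F 2 (leb Ω))
    (hJ : IsFlux Ω a F H J) (hb : DualFeasible Ω a H b) :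
    ∫ x in Ω, inner ℝ (F x) (b x - J x) ≤ 0 := by
  simp only [inner_sub_right]
  rw [integral_sub (integrable_inner_of_memLp_two hF hb.1.1)
    (integrable_inner_of_memLp_two hF hJ.1.1.1)]
  exact sub_nonpos.2 (hJ.2 b hb)

/-- The flux is unique when `s = a / ‖Du + F‖` is bounded, and equals `s • (Du + F)`. -/
theorem IsFlux.ae_eq_smul {σ₁ : ℝ} (hσ₁ : 0 < σ₁) {s : Space n → ℝ} {J : Space n → Space n}
    (hH : MemLp H 2 (leb Ω)) (hF : MemLp F 2 (leb Ω)) (hu : MemH10 Ω u Du)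
    (hs : ∀ᵐ x ∂leb Ω, 0 ≤ s x ∧ s x ≤ σ₁ ∧ a x = s x * ‖Du x + F x‖)
    (hJ₀ : DualFeasible Ω a H (fun x => s x • (Du x + F x))) (hJ : IsFlux Ω a F H J) :
    ∀ᵐ x ∂leb Ω, J x = s x • (Du x + F x) := by
  have hle := (integral_norm_sub_sq_le hH hF hu hs hJ₀ hJ.1).trans
    (mul_nonpos_of_nonneg_of_nonpos (by positivity) (hJ.integral_inner_sub_nonpos hF hJ₀))
  have hzero := (integral_eq_zero_iff_of_nonneg (fun _ => sq_nonneg _)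
    ((hJ₀.1.1.sub hJ.1.1.1).norm.integrable_sq)).1
    (le_antisymm hle (integral_nonneg fun _ => sq_nonneg _))
  filter_upwards [hzero] with x hx
  exact (sub_eq_zero.1 (norm_eq_zero.1 (pow_eq_zero_iff two_ne_zero |>.1 hx))).symm

/-- Stability of the flux in `L²(Ω)`. -/
theorem integral_norm_flux_sub_sq_le {M σ₁ : ℝ} (hσ₁ : 0 < σ₁) {F' J J' : Space n → Space n}
    [IsFiniteMeasure (leb Ω)]
    (haM : ∀ᵐ x ∂leb Ω, a x ≤ M) (hF : MemLp F 2 (leb Ω)) (hF' : MemLp F' 2 (leb Ω))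
    (hJ : DualFeasible Ω a H J) (hJ' : IsFlux Ω a F' H J')
    (hle : ∫ x in Ω, ‖J x - J' x‖ ^ 2 ≤ 2 * σ₁ * ∫ x in Ω, inner ℝ (F x) (J x - J' x)) :
    ∫ x in Ω, ‖J x - J' x‖ ^ 2 ≤ 4 * M * σ₁ * ∫ x in Ω, ‖F x - F' x‖ := by
  have hd : MemLp (fun x => J x - J' x) 2 (leb Ω) := hJ.1.1.sub hJ'.1.1.1
  have hG : MemLp (fun x => F x - F' x) 2 (leb Ω) := hF.sub hF'
  have hsplit : ∫ x in Ω, inner ℝ (F x) (J x - J' x) =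
      (∫ x in Ω, inner ℝ (F x - F' x) (J x - J' x)) + ∫ x in Ω, inner ℝ (F' x) (J x - J' x) := by
    rw [← integral_add (integrable_inner_of_memLp_two hG hd)
      (integrable_inner_of_memLp_two hF' hd)]
    simp only [← inner_add_left, sub_add_cancel]
  have hdiff : ∫ x in Ω, inner ℝ (F x - F' x) (J x - J' x) ≤
      2 * M * ∫ x in Ω, ‖F x - F' x‖ := by
    rw [← integral_const_mul]
    refine integral_mono_ae (integrable_inner_of_memLp_two hG hd)
      ((hG.norm.integrable one_le_two).const_mul _) ?_
    filter_upwards [haM, hJ.2, hJ'.1.2] with x h₁ h₂ h₃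
    have hnorm : ‖J x - J' x‖ ≤ 2 * M := (norm_sub_le _ _).trans (by linarith)
    calc inner ℝ (F x - F' x) (J x - J' x) ≤ ‖F x - F' x‖ * ‖J x - J' x‖ :=
          real_inner_le_norm _ _
      _ ≤ ‖F x - F' x‖ * (2 * M) := by gcongr
      _ = 2 * M * ‖F x - F' x‖ := mul_comm _ _
  have hmax := hJ'.integral_inner_sub_nonpos hF' hJ
  calc ∫ x in Ω, ‖J x - J' x‖ ^ 2 ≤ 2 * σ₁ * ∫ x in Ω, inner ℝ (F x) (J x - J' x) := hle
    _ ≤ 2 * σ₁ * (2 * M * ∫ x in Ω, ‖F x - F' x‖) := by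
      gcongr
      linarith
    _ = 4 * M * σ₁ * ∫ x in Ω, ‖F x - F' x‖ := by ring

end Flux

end LeastGradient

theorem mainTheorem5 {n : ℕ} (Ω : Set (LeastGradient.Space n))
    (hΩ_open : IsOpen Ω) (hΩ_bdd : Bornology.IsBounded Ω)
    (m M σ₁ : ℝ) (hm : 0 < m) (hσ₁ : 0 < σ₁)
    (a H : LeastGradient.Space n → ℝ)
    (F F' : LeastGradient.Space n → LeastGradient.Space n)
    (ha_meas : AEStronglyMeasurable a (LeastGradient.leb Ω))
    (ha : ∀ᵐ x ∂LeastGradient.leb Ω, m ≤ a x ∧ a x ≤ M)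
    (hH : MemLp H 2 (LeastGradient.leb Ω))
    (hF : MemLp F 2 (LeastGradient.leb Ω))
    (hF' : MemLp F' 2 (LeastGradient.leb Ω))
    (u u' : LeastGradient.Space n → ℝ)
    (Du Du' : LeastGradient.Space n → LeastGradient.Space n)
    (hu : LeastGradient.IsMinimizer Ω a F H u Du)
    (hu' : LeastGradient.IsMinimizer Ω a F' H u' Du')
    (J J' : LeastGradient.Space n → LeastGradient.Space n)
    (hJ : LeastGradient.IsFlux Ω a F H J)
    (hJ' : LeastGradient.IsFlux Ω a F' H J')
    (hσ : ∀ᵐ x ∂LeastGradient.leb Ω,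
      LeastGradient.sigma a F Du x ≤ ENNReal.ofReal σ₁) :
    ∫ x in Ω, ‖J x - J' x‖ ≤
      (4 * M * σ₁ * volume.real Ω) ^ (1 / 2 : ℝ) *
        (∫ x in Ω, ‖F x - F' x‖) ^ (1 / 2 : ℝ) := by
  -- On a null set `Ω` the constant `M` may be negative; both sides vanish there.
  rcases eq_or_ne (LeastGradient.leb Ω) 0 with h0 | h0
  · rw [LeastGradient.leb] at h0
    simp only [h0, integral_zero_measure]
    rw [Real.zero_rpow (by norm_num), mul_zero]
  have : NeZero (LeastGradient.leb Ω) := ⟨h0⟩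
  have : IsFiniteMeasure (LeastGradient.leb Ω) := ⟨by
    rw [Measure.restrict_apply_univ]
    exact hΩ_bdd.measure_lt_top⟩
  have hM : 0 < M := by
    obtain ⟨x, hx⟩ := ha.exists
    linarith
  have haM : ∀ᵐ x ∂LeastGradient.leb Ω, a x ≤ M := ha.mono fun _ hx => hx.2
  have hs := LeastGradient.ae_eq_div_norm_mul_norm_of_sigma_le hm hσ₁ ha hσ
  have hs_meas : AEStronglyMeasurable (fun x => a x / ‖Du x + F x‖) (LeastGradient.leb Ω) :=
    (ha_meas.aemeasurable.div
      (hu.1.memLp_grad.add hF).1.norm.aemeasurable).aestronglyMeasurable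
  have hJ₀ := LeastGradient.dualFeasible_smul_of_isMinimizer ha_meas haM hH hF hu hs_meas hs
  have hJ_eq := hJ.ae_eq_smul hσ₁ hH hF hu.1 hs hJ₀
  have hle := LeastGradient.integral_norm_sub_sq_le hH hF hu.1 hs hJ₀ hJ'.1
  have hle' : ∫ x in Ω, ‖J x - J' x‖ ^ 2 ≤
      2 * σ₁ * ∫ x in Ω, inner ℝ (F x) (J x - J' x) := by
    rw [integral_congr_ae (hJ_eq.mono fun x hx => congrArg (fun y => ‖y - J' x‖ ^ 2) hx),
      integral_congr_ae (hJ_eq.mono fun x hx => congrArg (fun y => inner ℝ (F x) (y - J' x)) hx)]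
    exact hle
  have hsq := LeastGradient.integral_norm_flux_sub_sq_le hσ₁ haM hF hF' hJ.1 hJ' hle'
  have hnn : 0 ≤ ∫ x in Ω, ‖F x - F' x‖ := integral_nonneg fun _ => norm_nonneg _
  have hCS := LeastGradient.integral_norm_le_sqrt_mul_sqrt (hJ.1.1.1.sub hJ'.1.1.1)
  simp only [Pi.sub_apply, measureReal_restrict_apply_univ] at hCS
  refine hCS.trans ?_
  rw [← Real.mul_rpow (integral_nonneg fun _ => sq_nonneg _) measureReal_nonneg,
    ← Real.mul_rpow (by positivity) hnn]
  refine Real.rpow_le_rpow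
    (mul_nonneg (integral_nonneg fun _ => sq_nonneg _) measureReal_nonneg) ?_ (by norm_num)
  exact (mul_le_mul_of_nonneg_right hsq measureReal_nonneg).trans_eq (by ring)
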